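/- Let $G$ be a (discrete) group. Actions of $G$ are right actions, and an action on a topological space is continuous if every $g\in G$ acts by a continuous map. Then the following are equivalent: 1. There is a right-invariant finitely additive probability measure on $G$, i.e. a map $\mu\colon\mathcal P(G)\to[0,1]$ with $\mu(G)=1$, $\mu(X\cup Y)=\mu(X)+\mu(Y)$ for all disjoint $X,Y\subseteq G$, and $\mu(Xg)=\mu(X)$ for all $X\subseteq G$, $g\in G$. 2. There is a right-invariant mean on $G$, i.e. a linear map $m\colon\ell^\infty_{\mathbb R}(G)\to\mathbb R$ with $m(1)=1$, $m(x)\ge 0$ whenever $x\ge 0$, and $m(x^g)=m(x)$ for all $x\in\ell^\infty_{\mathbb R}(G)$, $g\in G$, where $x^g(h)=x(hg^{-1})$. 3. $G$ satisfies the Følner condition: for every finite $X\subseteq G$ and every $\varepsilon>0$ there is a finite non-empty $F\subseteq G$ with $|F\setminus Fg|/|F|<\varepsilon$ for all $g\in X$. 4. There is a Følner net in $G$, i.e. a family $(F_i)_{i\in I}$ of finite non-empty subsets of $G$ indexed by a non-empty directed partially ordered set $I$ such that $\lim_{i\in I}|F_i\setminus F_ig|/|F_i|=0$ for every $g\in G$.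 5. $G$ is non-paradoxical: there do not exist subsets $X_1,\dots,X_n,Y_1,\dots,Y_m$ of $G$ and elements $g_1,\dots,g_n,h_1,\dots,h_m$ of $G$ such that $G$ is the disjoint union of $X_1,\dots,X_n,Y_1,\dots,Y_m$, is the disjoint union of $X_1g_1,\dots,X_ng_n$, and is the disjoint union of $Y_1h_1,\dots,Y_mh_m$. 6. Every affine continuous action of $G$ on a non-empty convex compact subset of a Hausdorff (real) topological vector space has a fixed point. 7. Every continuous action of $G$ on a non-empty compact Hausdorff topological space has an invariant Borel probability measure. -/

import Mathlib

universe u v w z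

namespace AmenableGroup

open scoped Pointwise ENNReal Topology RightActions
open MeasureTheory Filter

/-! Throughout, a right action of a group `G` on `Ω` is a `MulAction Gᵐᵒᵖ Ω`, and `ω <• g`
(resp. `X <• g`) is the point `ω g` (resp. the set `X g`).  The group `G` carries the discrete
topology, so an action of `G` is continuous if and only if each of its elements acts continuously,
i.e. `ContinuousConstSMul Gᵐᵒᵖ Ω`. -/

/-- A finitely additive probability measure on `G`, defined on all subsets of `G`. -/
structure FinAddProbMeasure (G : Type u) where
  toFun : Set G → ℝ
  mem_Icc : ∀ X : Set G, toFun X ∈ Set.Icc (0 : ℝ) 1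
  univ : toFun Set.univ = 1
  union : ∀ X Y : Set G, Disjoint X Y → toFun (X ∪ Y) = toFun X + toFun Y

/-- `μ (X g) = μ X` for all `X ⊆ G` and `g ∈ G`. -/
def FinAddProbMeasure.IsRightInvariant {G : Type u} [Group G] (μ : FinAddProbMeasure G) : Prop :=
  ∀ (X : Set G) (g : G), μ.toFun (X <• g) = μ.toFun X

/-- The Banach space of bounded real functions on `Ω`. -/
abbrev EllInfty (Ω : Type u) : Type u := lp (fun _ : Ω => ℝ) ∞

/-- The function `x ^ g`, given by `x ^ g (h) = x (h g⁻¹)`. -/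
def EllInfty.translate {G : Type u} [Group G] (x : EllInfty G) (g : G) : EllInfty G :=
  ⟨fun h => x (h * g⁻¹), memℓp_infty (by
    obtain ⟨C, hC⟩ := memℓp_infty_iff.1 (lp.memℓp x)
    exact ⟨C, by rintro _ ⟨h, rfl⟩; exact hC ⟨h * g⁻¹, rfl⟩⟩)⟩

/-- A mean on `G`: a normalised positive linear functional on the bounded functions. -/
structure Mean (G : Type u) where
  toLinearMap : EllInfty G →ₗ[ℝ] ℝ
  map_one : toLinearMap 1 = 1
  nonneg : ∀ x : EllInfty G, (∀ h : G, 0 ≤ x h) → 0 ≤ toLinearMap x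

/-- `m (x ^ g) = m x` for all bounded `x` and all `g ∈ G`. -/
def Mean.IsRightInvariant {G : Type u} [Group G] (m : Mean G) : Prop :=
  ∀ (x : EllInfty G) (g : G), m.toLinearMap (x.translate g) = m.toLinearMap x

open scoped Classical in
/-- The number `|F \ F g| / |F|`. -/
noncomputable def folnerRatio {G : Type u} [Group G] (F : Finset G) (g : G) : ℝ :=
  ((F \ (F <• g)).card : ℝ) / (F.card : ℝ)

/-- The Følner condition. -/
def FolnerCondition (G : Type u) [Group G] : Prop :=
  ∀ (X : Finset G) (ε : ℝ), 0 < ε →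
    ∃ F : Finset G, F.Nonempty ∧ ∀ g ∈ X, folnerRatio F g < ε

/-- `F` is a Følner net indexed by the (nonempty) directed set `I`. -/
structure IsFolnerNet {G : Type u} [Group G] {I : Type v} [PartialOrder I] [IsDirectedOrder I]
    [Nonempty I] (F : I → Finset G) : Prop where
  nonempty : ∀ i, (F i).Nonempty
  tendsto : ∀ g : G, Tendsto (fun i => folnerRatio (F i) g) atTop (𝓝 0)

/-- There is a Følner net in `G`. -/
def HasFolnerNet.{u', v'} (G : Type u') [Group G] : Prop :=
  ∃ (I : Type (max u' v')) (_ : PartialOrder I) (_ : IsDirectedOrder I) (_ : Nonempty I)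
    (F : I → Finset G), IsFolnerNet F

/-- A right action of `G` on a set `Ω` is paradoxical: `Ω` is the disjoint union of
`X₁, …, Xₙ, Y₁, …, Yₘ`, the disjoint union of the `Xᵢ gᵢ`, and the disjoint union of the
`Yⱼ hⱼ`. -/
def IsParadoxicalAction (G : Type u) [Group G] (Ω : Type v) [MulAction Gᵐᵒᵖ Ω] : Prop :=
  ∃ (n m : ℕ) (X : Fin n → Set Ω) (Y : Fin m → Set Ω) (g : Fin n → G) (h : Fin m → G),
    (Pairwise fun i j => Disjoint (X i) (X j)) ∧
    (Pairwise fun i j => Disjoint (Y i) (Y j)) ∧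
    (∀ i j, Disjoint (X i) (Y j)) ∧
    (⋃ i, X i) ∪ (⋃ j, Y j) = Set.univ ∧
    (Pairwise fun i j => Disjoint (X i <• g i) (X j <• g j)) ∧
    (⋃ i, X i <• g i) = Set.univ ∧
    (Pairwise fun i j => Disjoint (Y i <• h i) (Y j <• h j)) ∧
    (⋃ j, Y j <• h j) = Set.univ

/-- `G` is paradoxical: its action on itself by right multiplication is paradoxical. -/
def IsParadoxical (G : Type u) [Group G] : Prop := IsParadoxicalAction G G

/-- The right action of `G` on the subset `C` of a real vector space is affine: every `g ∈ G`
preserves the convex combinations that lie in `C`. -/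
def IsAffineAction (G : Type u) [Group G] {E : Type v} [AddCommGroup E] [Module ℝ E] (C : Set E)
    [MulAction Gᵐᵒᵖ C] : Prop :=
  ∀ (g : G) (x y p : C) (a b : ℝ), 0 ≤ a → 0 ≤ b → a + b = 1 →
    (p : E) = a • (x : E) + b • (y : E) →
    ((p <• g : C) : E) = a • ((x <• g : C) : E) + b • ((y <• g : C) : E)

/-- Every affine continuous action of `G` on a nonempty convex compact subset of a Hausdorff
topological vector space has a fixed point. -/
def HasFixedPointProperty.{u', v'} (G : Type u') [Group G] : Prop :=
  ∀ (E : Type (max u' v')) [AddCommGroup E] [Module ℝ E] [TopologicalSpace E]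
    [IsTopologicalAddGroup E] [ContinuousSMul ℝ E] [T2Space E] (C : Set E),
    C.Nonempty → Convex ℝ C → IsCompact C →
    ∀ [MulAction Gᵐᵒᵖ C] [ContinuousConstSMul Gᵐᵒᵖ C], IsAffineAction G C →
      ∃ c : C, ∀ g : G, c <• g = c

/-- Every continuous action of `G` on a nonempty compact Hausdorff space has an invariant Borel
probability measure. -/
def HasInvariantMeasureProperty.{u', v'} (G : Type u') [Group G] : Prop :=
  ∀ (Ω : Type (max u' v')) [TopologicalSpace Ω] [CompactSpace Ω] [T2Space Ω] [Nonempty Ω]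
    [MeasurableSpace Ω] [BorelSpace Ω] [MulAction Gᵐᵒᵖ Ω] [ContinuousConstSMul Gᵐᵒᵖ Ω],
    ∃ μ : Measure Ω, IsProbabilityMeasure μ ∧
      ∀ (g : G) (A : Set Ω), MeasurableSet A → μ (A <• g) = μ A

end AmenableGroup

namespace AmenableGroup

open scoped Pointwise ENNReal Topology RightActions
open MeasureTheory Filter

/-! The hard implication is from non-paradoxical to Følner. If the Følner condition fails for `X`
and `ε`, each finite `F` grows by a factor `1 + ε` under multiplication by `X ∪ {1}`, so some power
`K` satisfies `|F K| ≥ 2 |F|`. Hall's marriage theorem then embeds two disjoint copies of `G` in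
`G`, with displacements in `K`; Schröder–Bernstein makes them fill `G`, and cutting by displacement
gives a paradox. An invariant finitely additive measure excludes a paradox, since it would give `1 =
1 + 1`.

Averages over a Følner net are asymptotically invariant, so their ultralimits give invariant means
and fixed points. A mean gives a measure on `G` by evaluation on indicators, and one on a compact
space by pulling functions back along an orbit and applying Riesz. The fixed point and invariant
measure properties return a finitely additive measure when applied to the space of all such measures
and to the ultrafilters on `G`. -/

/-! ### Failure of the Følner condition produces a paradox -/

open scoped Classical in
theorem card_sdiff_smul_eq {G : Type u} [Group G] (F : Finset G) (g : G) :
    (F \ (F <• g)).card = ((F <• g) \ F).card := by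
  have hcard : (F <• g).card = F.card := Finset.card_smul_finset _ _
  have e1 := Finset.card_sdiff_add_card_inter F (F <• g)
  have e2 := Finset.card_sdiff_add_card_inter (F <• g) F
  rw [Finset.inter_comm] at e2
  omega

-- The product `F * S` contains `F ∪ F g`, and `F g \ F` is as large as `F \ F g`.
open scoped Classical in
theorem card_add_card_sdiff_le {G : Type u} [Group G] (F S : Finset G) (g : G) (h1 : 1 ∈ S)
    (hg : g ∈ S) : F.card + (F \ (F <• g)).card ≤ (F * S).card := by
  rw [card_sdiff_smul_eq, add_comm, ← Finset.card_union_of_disjoint Finset.sdiff_disjoint]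
  apply Finset.card_le_card
  intro x hx
  rw [Finset.mem_union, Finset.mem_sdiff] at hx
  rcases hx with ⟨hx, -⟩ | hx
  · obtain ⟨y, hy, rfl⟩ := Finset.mem_smul_finset.1 hx
    exact Finset.mul_mem_mul hy hg
  · simpa using Finset.mul_mem_mul hx h1

open scoped Classical in
/-- A group that fails the Følner condition is uniformly doubling. -/
theorem exists_doubling_of_not_folnerCondition {G : Type u} [Group G] (hG : ¬ FolnerCondition G) :
    ∃ K : Finset G, ∀ F : Finset G, 2 * F.card ≤ (F * K).card := by
  simp only [FolnerCondition, not_forall, not_exists, not_and, not_lt] at hG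
  obtain ⟨X, ε, hε, hX⟩ := hG
  have step : ∀ F : Finset G, (1 + ε) * F.card ≤ ((F * insert 1 X).card : ℝ) := by
    intro F
    rcases F.eq_empty_or_nonempty with rfl | hF
    · simp
    obtain ⟨g, hg, h⟩ := hX F hF
    have hpos : (0 : ℝ) < F.card := by exact_mod_cast hF.card_pos
    rw [folnerRatio, le_div_iff₀ hpos] at h
    have := card_add_card_sdiff_le F (insert 1 X) g (Finset.mem_insert_self _ _)
      (Finset.mem_insert_of_mem hg)
    have h3 : (F.card : ℝ) + (F \ (F <• g)).card ≤ (F * insert 1 X).card := by exact_mod_cast this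
    linarith
  have iter : ∀ (n : ℕ) (F : Finset G),
      (1 + ε) ^ n * F.card ≤ ((F * (insert 1 X) ^ n).card : ℝ) := by
    intro n F
    induction n with
    | zero => simp
    | succ n ih =>
      rw [pow_succ (insert 1 X), ← mul_assoc]
      refine le_trans ?_ (step _)
      rw [pow_succ', mul_assoc]
      gcongr
  obtain ⟨n, hn⟩ := pow_unbounded_of_one_lt 2 (by linarith : (1 : ℝ) < 1 + ε)
  refine ⟨(insert 1 X) ^ n, fun F => ?_⟩
  have := (mul_le_mul_of_nonneg_right hn.le (Nat.cast_nonneg F.card)).trans (iter n F)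
  exact_mod_cast this

-- Hall's theorem, where `(a, b)` may take any value in `a K`: a set of pairs with first coordinates
-- `A` has at most `2 |A| ≤ |A K|` elements.
open scoped Classical in
theorem exists_injective_of_doubling {G : Type u} [Group G] (K : Finset G)
    (hK : ∀ F : Finset G, 2 * F.card ≤ (F * K).card) :
    ∃ φ : G × Bool → G, Function.Injective φ ∧ ∀ x, x.1⁻¹ * φ x ∈ K := by
  obtain ⟨φ, hφ, hmem⟩ := (Finset.all_card_le_biUnion_card_iff_exists_injective
    (fun x : G × Bool => x.1 • K)).1 (fun s => by
      have h1 : s.card ≤ 2 * (s.image Prod.fst).card := by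
        calc s.card ≤ (s.image Prod.fst ×ˢ (Finset.univ : Finset Bool)).card :=
              Finset.card_le_card fun x hx => by
                exact Finset.mem_product.2 ⟨Finset.mem_image_of_mem _ hx, Finset.mem_univ _⟩
          _ = _ := by rw [Finset.card_product, mul_comm]; simp
      refine h1.trans ((hK _).trans (Finset.card_le_card ?_))
      intro y hy
      obtain ⟨a, ha, k, hk, rfl⟩ := Finset.mem_mul.1 hy
      obtain ⟨x, hx, rfl⟩ := Finset.mem_image.1 ha
      exact Finset.mem_biUnion.2 ⟨x, hx, Finset.smul_mem_smul_finset hk⟩)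
  refine ⟨φ, hφ, fun x => ?_⟩
  obtain ⟨k, hk, h⟩ := Finset.mem_smul_finset.1 (hmem x)
  rw [← h]
  simpa using hk

/-- The Schröder–Bernstein step: the image of an injection `f` may be enlarged to any larger set
`B`, changing `f` to the identity at some points. -/
theorem exists_injective_range_eq {α : Type u} (f : α → α) (hf : Function.Injective f) (B : Set α)
    (hB : Set.range f ⊆ B) :
    ∃ ψ : α → α, Function.Injective ψ ∧ Set.range ψ = B ∧ ∀ x, ψ x = x ∨ ψ x = f x := by
  obtain ⟨ψ, hψ, h⟩ := Function.Embedding.schroeder_bernstein_of_rel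
    (f := fun x => (⟨f x, hB ⟨x, rfl⟩⟩ : B)) (g := Subtype.val)
    (fun x y h => hf (congrArg Subtype.val h)) Subtype.val_injective
    (fun x b => (b : α) = x ∨ (b : α) = f x) (fun _ => Or.inr rfl) (fun _ => Or.inl rfl)
  exact ⟨fun x => ψ x, Subtype.val_injective.comp hψ.1,
    by rw [Set.range_comp' Subtype.val ψ, hψ.2.range_eq, Set.image_univ, Subtype.range_val], h⟩

/-- The image of an injection with finitely many displacements is equidecomposable with the
group. -/
theorem exists_pieces_of_injective {G : Type u} [Group G] (f : G → G) (hf : Function.Injective f)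
    (K : Finset G) (hK : ∀ x, x⁻¹ * f x ∈ K) :
    ∃ (n : ℕ) (X : Fin n → Set G) (g : Fin n → G),
      (Pairwise fun i j => Disjoint (X i) (X j)) ∧ (⋃ i, X i) = Set.range f ∧
      (Pairwise fun i j => Disjoint (X i <• g i) (X j <• g j)) ∧
      (⋃ i, X i <• g i) = Set.univ := by
  let e := K.equivFin.symm
  let Z : Fin K.card → Set G := fun i => {x | x⁻¹ * f x = e i}
  have hZ : Pairwise fun i j => Disjoint (Z i) (Z j) := by
    intro i j hij
    rw [Set.disjoint_left]
    intro x hx hy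
    exact hij (e.injective (Subtype.ext (hx.symm.trans hy)))
  have hZu : (⋃ i, Z i) = Set.univ := by
    refine Set.eq_univ_of_forall fun x => Set.mem_iUnion.2 ⟨e.symm ⟨_, hK x⟩, ?_⟩
    simp [Z]
  -- On `Z i` the map `f` is right multiplication by `e i`, so the inverse translation undoes it.
  have htr : ∀ i, (f '' Z i) <• ((e i : G)⁻¹) = Z i := by
    intro i
    have : ∀ x ∈ Z i, f x * (e i : G)⁻¹ = x := by
      intro x hx
      rw [← show x⁻¹ * f x = e i from hx]
      group
    ext y
    rw [Set.mem_smul_set]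
    constructor
    · rintro ⟨_, ⟨x, hx, rfl⟩, rfl⟩
      simpa [this x hx] using hx
    · exact fun hy => ⟨f y, ⟨y, hy, rfl⟩, by simpa using this y hy⟩
  refine ⟨K.card, fun i => f '' Z i, fun i => (e i : G)⁻¹, ?_, ?_, ?_, ?_⟩
  · exact fun i j hij => (Set.disjoint_image_iff hf).2 (hZ hij)
  · rw [← Set.image_iUnion, hZu, Set.image_univ]
  · intro i j hij
    simpa only [htr] using hZ hij
  · simpa only [htr] using hZu

theorem isParadoxical_of_injective {G : Type u} [Group G] (K : Finset G) (φ : G × Bool → G)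
    (hφ : Function.Injective φ) (hK : ∀ x, x.1⁻¹ * φ x ∈ K) : IsParadoxical G := by
  classical
  obtain ⟨ψ, hψ, hrange, hψe⟩ := exists_injective_range_eq (fun x => φ (x, true))
    (fun x y h => congrArg Prod.fst (hφ h)) (Set.range fun x => φ (x, false))ᶜ (by
      rintro _ ⟨x, rfl⟩ ⟨y, hy⟩
      simpa using congrArg Prod.snd (hφ hy))
  obtain ⟨n, X, g, hX, hXu, hXg, hXgu⟩ := exists_pieces_of_injective (fun x => φ (x, false))
    (fun x y h => congrArg Prod.fst (hφ h)) K fun x => hK (x, false)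
  -- The points where `ψ` is the identity have displacement `1`.
  obtain ⟨m, Y, h, hY, hYu, hYh, hYhu⟩ := exists_pieces_of_injective ψ hψ (insert 1 K) fun x => by
    rcases hψe x with h | h <;> rw [h]
    · simp
    · exact Finset.mem_insert_of_mem (hK (x, true))
  refine ⟨n, m, X, Y, g, h, hX, hY, fun i j => ?_, ?_, hXg, hXgu, hYh, hYhu⟩
  · refine Disjoint.mono (Set.subset_iUnion X i) (Set.subset_iUnion Y j) ?_
    rw [hXu, hYu, hrange]
    exact disjoint_compl_right
  · rw [hXu, hYu, hrange, Set.union_compl_self]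

theorem folnerCondition_of_not_isParadoxical {G : Type u} [Group G] (hG : ¬ IsParadoxical G) :
    FolnerCondition G := by
  by_contra h
  obtain ⟨K, hK⟩ := exists_doubling_of_not_folnerCondition h
  obtain ⟨φ, hφ, hφK⟩ := exists_injective_of_doubling K hK
  exact hG (isParadoxical_of_injective K φ hφ hφK)

/-! ### Invariant measures exclude paradoxes; Følner nets -/

theorem FinAddProbMeasure.empty {G : Type u} (μ : FinAddProbMeasure G) : μ.toFun ∅ = 0 := by
  simpa using μ.union ∅ ∅ (by simp)

theorem FinAddProbMeasure.iUnion {G : Type u} (μ : FinAddProbMeasure G) {ι : Type*} [Fintype ι]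
    (X : ι → Set G) (hX : Pairwise fun i j => Disjoint (X i) (X j)) :
    μ.toFun (⋃ i, X i) = ∑ i, μ.toFun (X i) := by
  classical
  have : ∀ s : Finset ι, μ.toFun (⋃ i ∈ s, X i) = ∑ i ∈ s, μ.toFun (X i) := by
    intro s
    induction s using Finset.induction_on with
    | empty => simp [μ.empty]
    | insert a s ha ih =>
      rw [Finset.set_biUnion_insert, μ.union, ih, Finset.sum_insert ha]
      exact Set.disjoint_iUnion₂_right.2 fun i hi => hX (by rintro rfl; exact ha hi)
  simpa using this Finset.univ

theorem not_isParadoxical_of_finAddProbMeasure {G : Type u} [Group G] (μ : FinAddProbMeasure G)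
    (hμ : μ.IsRightInvariant) : ¬ IsParadoxical G := by
  rintro ⟨n, m, X, Y, g, h, hX, hY, hXY, hu, hXg, hXgu, hYh, hYhu⟩
  have e1 := μ.iUnion _ hXg
  have e2 := μ.iUnion _ hYh
  have e3 := μ.union _ _ (Set.disjoint_iUnion_left.2 fun i => Set.disjoint_iUnion_right.2 (hXY i))
  simp only [hXgu, hYhu, hu, μ.univ, hμ _ _, μ.iUnion X hX, μ.iUnion Y hY] at e1 e2 e3
  linarith

theorem hasFolnerNet_of_folnerCondition {G : Type u} [Group G] (hG : FolnerCondition G) :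
    HasFolnerNet.{u, v} G := by
  classical
  -- The net is indexed by pairs (finite set, precision), ordered componentwise.
  choose F hF hlt using fun i : Finset G × ℕ => hG i.1 (1 / ((i.2 : ℝ) + 1)) (by positivity)
  let I := ULift.{v} (Finset G × ℕ)
  have hI : IsDirectedOrder I :=
    ⟨fun a b => ⟨⟨a.down ⊔ b.down⟩, (le_sup_left : a.down ≤ a.down ⊔ b.down),
      (le_sup_right : b.down ≤ a.down ⊔ b.down)⟩⟩
  refine ⟨I, inferInstance, hI, inferInstance, fun i => F i.down, fun i => hF _, fun g => ?_⟩
  rw [Metric.tendsto_atTop]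
  intro ε hε
  obtain ⟨n, hn⟩ := exists_nat_one_div_lt hε
  refine ⟨⟨({g}, n)⟩, fun i hi => ?_⟩
  have hi' : (({g}, n) : Finset G × ℕ) ≤ i.down := hi
  have h1 := hlt i.down g (hi'.1 (Finset.mem_singleton_self g))
  have h0 : 0 ≤ folnerRatio (F i.down) g := by unfold folnerRatio; positivity
  rw [Real.dist_eq, sub_zero, abs_of_nonneg h0]
  refine h1.trans (lt_of_le_of_lt ?_ hn)
  have : (n : ℝ) ≤ i.down.2 := by exact_mod_cast hi'.2
  gcongr

/-! ### Asymptotic invariance of Følner averages -/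

section Average

variable {G : Type u} {E : Type v} [AddCommGroup E] [Module ℝ E]

/-- The average of `f` over the finite set `F`. -/
noncomputable def average (f : G → E) (F : Finset G) : E := (F.card : ℝ)⁻¹ • ∑ h ∈ F, f h

theorem average_mem {C : Set E} (hC : Convex ℝ C) {f : G → E} (hf : ∀ h, f h ∈ C) {F : Finset G}
    (hF : F.Nonempty) : average f F ∈ C := by
  have hpos : (F.card : ℝ) ≠ 0 := by exact_mod_cast hF.card_pos.ne'
  rw [average, Finset.smul_sum]
  exact hC.sum_mem (fun _ _ => by positivity) (by simp [hpos]) fun h _ => hf h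

theorem card_smul_average (f : G → E) (F : Finset G) :
    (F.card : ℝ) • average f F = ∑ h ∈ F, f h := by
  rcases F.eq_empty_or_nonempty with rfl | hF
  · simp
  · have hpos : (F.card : ℝ) ≠ 0 := by exact_mod_cast hF.card_pos.ne'
    rw [average, smul_inv_smul₀ hpos]

variable [Group G]

-- The sums over `F g` and `F` differ only on `F g \ F` and `F \ F g`, which have equal size; `p`
-- and `q` are the averages over these two sets. Keeping them in `C` avoids any norm on `E`.
open scoped Classical in
theorem exists_average_translate_sub {C : Set E} (hC : Convex ℝ C) {f : G → E}
    (hf : ∀ h, f h ∈ C) (F : Finset G) (g : G) :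
    ∃ p ∈ C, ∃ q ∈ C,
      average (fun h => f (h * g)) F - average f F = folnerRatio F g • (p - q) := by
  have hsum : ∑ h ∈ F, f (h * g) = ∑ h ∈ F <• g, f h := by
    rw [← Finset.image_smul, Finset.sum_image (MulAction.injective _).injOn]
    rfl
  rcases (F \ (F <• g)).eq_empty_or_nonempty with h0 | hne
  · refine ⟨f 1, hf 1, f 1, hf 1, ?_⟩
    have h0' : (F <• g) \ F = ∅ := by
      rw [← Finset.card_eq_zero, ← card_sdiff_smul_eq, h0, Finset.card_empty]
    have : F <• g = F := (Finset.sdiff_eq_empty_iff_subset.1 h0').antisymm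
      (Finset.sdiff_eq_empty_iff_subset.1 h0)
    rw [average, average, hsum, this]
    simp
  · have hne' : ((F <• g) \ F).Nonempty := by
      rwa [← Finset.card_pos, ← card_sdiff_smul_eq, Finset.card_pos]
    refine ⟨_, average_mem hC hf hne', _, average_mem hC hf hne, ?_⟩
    rw [average, average, hsum, ← smul_sub, folnerRatio, div_eq_inv_mul, mul_smul,
      smul_sub _ (average f _), card_smul_average, card_sdiff_smul_eq, card_smul_average]
    congr 1
    rw [Finset.sum_sdiff_sub_sum_sdiff]

variable [TopologicalSpace E] [IsTopologicalAddGroup E] [ContinuousSMul ℝ E]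

/-- Compactness of `C` stands in for boundedness: along any ultrafilter `p` and `q` converge, while
their scalar factor tends to `0`. -/
theorem tendsto_average_translate_sub {C : Set E} (hC : Convex ℝ C) (hC' : IsCompact C)
    {f : G → E} (hf : ∀ h, f h ∈ C) {I : Type w} {l : Filter I} {F : I → Finset G} {g : G}
    (hF : Tendsto (fun i => folnerRatio (F i) g) l (𝓝 0)) :
    Tendsto (fun i => average (fun h => f (h * g)) (F i) - average f (F i)) l (𝓝 0) := by
  choose p hp q hq h using fun i => exists_average_translate_sub hC hf (F i) g
  simp only [h]
  rw [tendsto_iff_ultrafilter]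
  intro U hU
  obtain ⟨a, -, ha⟩ := hC'.ultrafilter_le_nhds (U.map p) (by
    rw [le_principal_iff]; exact Filter.Eventually.of_forall (f := (U : Filter I)) hp)
  obtain ⟨b, -, hb⟩ := hC'.ultrafilter_le_nhds (U.map q) (by
    rw [le_principal_iff]; exact Filter.Eventually.of_forall (f := (U : Filter I)) hq)
  have ha' : Tendsto p U (𝓝 a) := ha
  have hb' : Tendsto q U (𝓝 b) := hb
  simpa using (hF.mono_left hU).smul (ha'.sub hb')

end Average

/-! ### Fixed points and means as ultralimits of averages -/

theorem IsAffineAction.smul_average {G : Type u} [Group G] {E : Type v} [AddCommGroup E]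
    [Module ℝ E] {C : Set E} (hC : Convex ℝ C) [MulAction Gᵐᵒᵖ C] (h : IsAffineAction G C) (g : G)
    (z : G → C) {F : Finset G} (hF : F.Nonempty) (p : C)
    (hp : (p : E) = average (fun x => (z x : E)) F) :
    ((p <• g : C) : E) = average (fun x => ((z x <• g : C) : E)) F := by
  induction hF using Finset.Nonempty.cons_induction generalizing p with
  | singleton a =>
    have : p = z a := Subtype.ext (by simpa [average] using hp)
    simp [average, this]
  | cons a s ha hs ih =>
    have key : ∀ f : G → E, average f (s.cons a ha) =
        ((s.card : ℝ) + 1)⁻¹ • f a + ((s.card : ℝ) / (s.card + 1)) • average f s := by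
      intro f
      rw [div_eq_inv_mul, mul_smul, card_smul_average, ← smul_add, average]
      simp
    have hmem : average (fun x => (z x : E)) s ∈ C := average_mem hC (fun x => (z x).2) hs
    rw [key] at hp ⊢
    rw [h g (z a) ⟨_, hmem⟩ p _ _ (by positivity) (by positivity) (by field_simp; ring) hp,
      ih ⟨_, hmem⟩ rfl]

/-- The fixed point is an ultralimit of Følner averages of a single orbit. -/
theorem hasFixedPointProperty_of_hasFolnerNet {G : Type u} [Group G] (hG : HasFolnerNet.{u, v} G) :
    HasFixedPointProperty.{u, w} G := by
  obtain ⟨I, _, _, _, F, hF⟩ := hG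
  intro E _ _ _ _ _ _ C hne hC hC' _ _ haff
  obtain ⟨c₀, hc₀⟩ := hne
  let f : G → C := fun h => (⟨c₀, hc₀⟩ : C) <• h
  let a : I → C := fun i => ⟨average (fun h => (f h : E)) (F i),
    average_mem hC (fun h => (f h).2) (hF.nonempty i)⟩
  let U : Ultrafilter I := Ultrafilter.of atTop
  have hU : (U : Filter I) ≤ atTop := Ultrafilter.of_le _
  have : CompactSpace C := isCompact_iff_compactSpace.1 hC'
  obtain ⟨c, -, hc⟩ := isCompact_univ.ultrafilter_le_nhds (U.map a) (by simp)
  have hac : Tendsto a U (𝓝 c) := hc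
  refine ⟨c, fun g => Subtype.ext ?_⟩
  have h1 : Tendsto (fun i => ((a i <• g : C) : E)) U (𝓝 (c <• g : C)) :=
    (continuous_subtype_val.tendsto _).comp (((continuous_const_smul _).tendsto c).comp hac)
  have h2 : Tendsto (fun i => (a i : E)) U (𝓝 c) := (continuous_subtype_val.tendsto _).comp hac
  have h3 : ∀ i, ((a i <• g : C) : E) = average (fun h => (f (h * g) : E)) (F i) := by
    intro i
    rw [haff.smul_average hC g f (hF.nonempty i) (a i) rfl]
    simp only [f, MulOpposite.op_mul, mul_smul]
  simp only [h3] at h1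
  have h4 := (tendsto_average_translate_sub hC hC' (fun h => (f h).2) (hF.tendsto g)).mono_left hU
  exact sub_eq_zero.1 (tendsto_nhds_unique (h1.sub h2) h4)

theorem EllInfty.exists_forall_mem_Icc {Ω : Type u} (x : EllInfty Ω) :
    ∃ R : ℝ, ∀ h, x h ∈ Set.Icc (-R) R := by
  obtain ⟨R, hR⟩ := memℓp_infty_iff.1 (lp.memℓp x)
  exact ⟨R, fun h => abs_le.1 (hR ⟨h, rfl⟩)⟩

theorem exists_mean_of_hasFolnerNet {G : Type u} [Group G] (hG : HasFolnerNet.{u, v} G) :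
    ∃ m : Mean G, m.IsRightInvariant := by
  obtain ⟨I, _, _, _, F, hF⟩ := hG
  let U : Ultrafilter I := Ultrafilter.of atTop
  have hU : (U : Filter I) ≤ atTop := Ultrafilter.of_le _
  have hlim : ∀ x : EllInfty G, ∃ c : ℝ, Tendsto (fun i => average x (F i)) U (𝓝 c) := by
    intro x
    obtain ⟨R, hR⟩ := x.exists_forall_mem_Icc
    obtain ⟨c, -, hc⟩ := (isCompact_Icc (a := -R) (b := R)).ultrafilter_le_nhds
      (U.map fun i => average x (F i)) (by
        rw [le_principal_iff]
        exact Filter.Eventually.of_forall (f := (U : Filter I)) fun i =>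
          average_mem (convex_Icc _ _) hR (hF.nonempty i))
    exact ⟨c, hc⟩
  choose m hm using hlim
  let M : Mean G :=
    { toLinearMap :=
        { toFun := m
          map_add' := fun x y => tendsto_nhds_unique (hm (x + y)) (by
            refine ((hm x).add (hm y)).congr fun i => ?_
            simp only [average, lp.coeFn_add, Pi.add_apply, Finset.sum_add_distrib, smul_add])
          map_smul' := fun c x => tendsto_nhds_unique (hm (c • x)) (by
            simpa [average, ← Finset.mul_sum, mul_left_comm] using (hm x).const_mul c) }
      map_one := tendsto_nhds_unique (hm 1) (tendsto_const_nhds.congr fun i => by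
        have : ((F i).card : ℝ) ≠ 0 := by exact_mod_cast (hF.nonempty i).card_pos.ne'
        simp [average, lp.infty_coeFn_one, this])
      nonneg := fun x hx => ge_of_tendsto' (hm x) fun i =>
        smul_nonneg (by positivity) (Finset.sum_nonneg fun h _ => hx h) }
  refine ⟨M, fun x g => ?_⟩
  obtain ⟨R, hR⟩ := x.exists_forall_mem_Icc
  -- The inverse appears because `x.translate g` evaluates `x` at `h * g⁻¹`.
  have h := (tendsto_average_translate_sub (convex_Icc _ _) isCompact_Icc hR
    (hF.tendsto g⁻¹)).mono_left hU
  exact sub_eq_zero.1 (tendsto_nhds_unique ((hm (x.translate g)).sub (hm x)) h)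

/-- The indicator function of `X`, as a bounded function. -/
noncomputable def EllInfty.indicator {Ω : Type u} (X : Set Ω) : EllInfty Ω :=
  ⟨X.indicator 1, memℓp_infty ⟨1, by
    rintro _ ⟨h, rfl⟩
    by_cases hx : h ∈ X <;> simp [hx]⟩⟩

theorem EllInfty.coe_indicator {Ω : Type u} (X : Set Ω) :
    ⇑(EllInfty.indicator X) = X.indicator 1 := rfl

/-- The finitely additive probability measure obtained by restricting a mean to indicator
functions. -/
noncomputable def Mean.toFinAddProbMeasure {G : Type u} (m : Mean G) : FinAddProbMeasure G where
  toFun X := m.toLinearMap (EllInfty.indicator X)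
  mem_Icc X := by
    refine ⟨m.nonneg _ fun h => Set.indicator_nonneg (by simp) h, ?_⟩
    have := m.nonneg (1 - EllInfty.indicator X) fun h => by
      rw [lp.coeFn_sub, lp.infty_coeFn_one, EllInfty.coe_indicator]
      by_cases hx : h ∈ X <;> simp [hx]
    rw [map_sub, m.map_one] at this
    linarith
  univ := by
    rw [← m.map_one]
    congr 1
    ext h
    simp [EllInfty.coe_indicator, lp.infty_coeFn_one]
  union X Y hXY := by
    rw [← map_add]
    congr 1
    ext h
    simp only [EllInfty.coe_indicator, lp.coeFn_add, Set.indicator_union_of_disjoint hXY,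
      Pi.add_apply]

theorem Mean.IsRightInvariant.toFinAddProbMeasure {G : Type u} [Group G] {m : Mean G}
    (hm : m.IsRightInvariant) : m.toFinAddProbMeasure.IsRightInvariant := by
  intro X g
  refine Eq.trans (congrArg m.toLinearMap ?_) (hm (EllInfty.indicator X) g)
  ext h
  change (X <• g).indicator 1 h = X.indicator 1 (h * g⁻¹)
  have : h ∈ X <• g ↔ h * g⁻¹ ∈ X := by
    rw [Set.mem_smul_set_iff_inv_smul_mem]; rfl
  by_cases hx : h * g⁻¹ ∈ X
  · rw [Set.indicator_of_mem hx, Set.indicator_of_mem (this.2 hx)]; rfl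
  · rw [Set.indicator_of_notMem hx, Set.indicator_of_notMem (mt this.1 hx)]

/-! ### The compact convex space of finitely additive measures -/

section FixedPoint

variable (G : Type u)

/-- The finitely additive probability measures on `G`, as a set of functions on the (lifted)
power set. -/
def finAddProbMeasureSet : Set (ULift.{w} (Set G) → ℝ) :=
  {f | (∀ X, f X ∈ Set.Icc (0 : ℝ) 1) ∧ f ⟨Set.univ⟩ = 1 ∧
    ∀ X Y : Set G, Disjoint X Y → f ⟨X ∪ Y⟩ = f ⟨X⟩ + f ⟨Y⟩}

theorem finAddProbMeasureSet_nonempty [Nonempty G] :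
    (finAddProbMeasureSet.{u, w} G).Nonempty := by
  classical
  obtain ⟨a⟩ := ‹Nonempty G›
  refine ⟨fun X => X.down.indicator 1 a, fun X => ?_, by simp, fun X Y hXY => ?_⟩
  · by_cases h : a ∈ X.down <;> simp [h]
  · simp [Set.indicator_union_of_disjoint hXY]

theorem convex_finAddProbMeasureSet : Convex ℝ (finAddProbMeasureSet.{u, w} G) := by
  rintro f ⟨hf, hf1, hfa⟩ f' ⟨hf', hf1', hfa'⟩ a b ha hb hab
  refine ⟨fun X => (convex_Icc (0 : ℝ) 1) (hf X) (hf' X) ha hb hab, ?_, fun X Y hXY => ?_⟩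
  · simp [hf1, hf1', hab]
  · simp only [Pi.add_apply, Pi.smul_apply, hfa X Y hXY, hfa' X Y hXY, smul_eq_mul]
    ring

theorem isCompact_finAddProbMeasureSet : IsCompact (finAddProbMeasureSet.{u, w} G) := by
  refine (isCompact_univ_pi (s := fun _ : ULift.{w} (Set G) => Set.Icc (0 : ℝ) 1)
    fun _ => isCompact_Icc).of_isClosed_subset ?_ fun f hf X _ => hf.1 X
  simp only [finAddProbMeasureSet, Set.ofPred_and, Set.ofPred_forall]
  refine (isClosed_iInter fun X => isClosed_Icc.preimage (continuous_apply X)).inter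
    ((isClosed_eq (continuous_apply _) continuous_const).inter ?_)
  exact isClosed_iInter fun X => isClosed_iInter fun Y => isClosed_iInter fun _ =>
    isClosed_eq (by fun_prop) (by fun_prop)

variable [Group G]

/-- The right action of `G` on the finitely additive probability measures:
`(μ g) X = μ (X g⁻¹)`. -/
instance : MulAction Gᵐᵒᵖ (finAddProbMeasureSet.{u, w} G) where
  smul a f := ⟨fun X => f.1 ⟨a⁻¹ • X.down⟩, fun X => f.2.1 _,
    by simpa using f.2.2.1, fun X Y hXY => by
      simpa only [Set.smul_set_union] using f.2.2.2 _ _ (Set.disjoint_smul_set.2 hXY)⟩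
  one_smul f := Subtype.ext (funext fun X => congrArg (fun Y => f.1 ⟨Y⟩)
    (show (1 : Gᵐᵒᵖ)⁻¹ • X.down = X.down by simp))
  mul_smul a b f := Subtype.ext (funext fun X => congrArg (fun Y => f.1 ⟨Y⟩)
    (show (a * b)⁻¹ • X.down = b⁻¹ • a⁻¹ • X.down by rw [mul_inv_rev, mul_smul]))

variable {G}

theorem coe_smul_finAddProbMeasureSet (a : Gᵐᵒᵖ) (f : finAddProbMeasureSet.{u, w} G)
    (X : ULift.{w} (Set G)) : (a • f).1 X = f.1 ⟨a⁻¹ • X.down⟩ := rfl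

instance : ContinuousConstSMul Gᵐᵒᵖ (finAddProbMeasureSet.{u, w} G) where
  continuous_const_smul a := Continuous.subtype_mk
    (f := fun (f : finAddProbMeasureSet.{u, w} G) (X : ULift.{w} (Set G)) => f.1 ⟨a⁻¹ • X.down⟩)
    (continuous_pi fun X => (continuous_apply (⟨a⁻¹ • X.down⟩ : ULift.{w} (Set G))).comp
      continuous_subtype_val) _

theorem exists_finAddProbMeasure_of_hasFixedPointProperty
    (hG : HasFixedPointProperty.{u, w} G) : ∃ μ : FinAddProbMeasure G, μ.IsRightInvariant := by
  obtain ⟨c, hc⟩ := hG (ULift.{w} (Set G) → ℝ) (finAddProbMeasureSet.{u, w} G)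
    (finAddProbMeasureSet_nonempty G) (convex_finAddProbMeasureSet G)
    (isCompact_finAddProbMeasureSet G) (by
      intro g x y p a b _ _ _ hp
      funext X
      simp only [Pi.add_apply, Pi.smul_apply, coe_smul_finAddProbMeasureSet, hp])
  refine ⟨⟨fun X => c.1 ⟨X⟩, fun X => c.2.1 _, c.2.2.1, c.2.2.2⟩, fun X g => ?_⟩
  have h := congrFun (congrArg Subtype.val (hc g⁻¹)) ⟨X⟩
  simpa [coe_smul_finAddProbMeasureSet] using h

end FixedPoint

/-! ### Measures on the space of ultrafilters -/

section Ultrafilters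

variable {G : Type u} [Group G]

/-- The right action of `G` on the Stone–Čech compactification of its lift. -/
instance : MulAction Gᵐᵒᵖ (Ultrafilter (ULift.{z} G)) where
  smul a U := U.map (a • ·)
  one_smul U := by
    change U.map _ = U
    simp
  mul_smul a b U := by
    change U.map _ = (U.map _).map _
    rw [Ultrafilter.map_map]
    congr 1
    funext x
    exact mul_smul a b x

theorem mem_smul_ultrafilter (a : Gᵐᵒᵖ) (U : Ultrafilter (ULift.{z} G)) (s : Set (ULift.{z} G)) :
    s ∈ a • U ↔ a⁻¹ • s ∈ U := by
  change (a • ·) ⁻¹' s ∈ U ↔ _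
  rw [Set.preimage_smul]

instance : ContinuousConstSMul Gᵐᵒᵖ (Ultrafilter (ULift.{z} G)) where
  continuous_const_smul a := by
    refine ultrafilterBasis_is_basis.continuous_iff.2 ?_
    rintro _ ⟨s, rfl⟩
    convert! ultrafilter_isOpen_basic (a⁻¹ • s) using 1
    ext U
    exact mem_smul_ultrafilter a U s

/-- The basic open set `B X` of ultrafilters containing the lift of `X` turns disjoint unions and
translates in `G` into the same operations on Borel sets, so `X ↦ ν (B X)` inherits additivity and
invariance. -/
theorem exists_finAddProbMeasure_of_hasInvariantMeasureProperty
    (hG : HasInvariantMeasureProperty.{u, z} G) :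
    ∃ μ : FinAddProbMeasure G, μ.IsRightInvariant := by
  let _ : MeasurableSpace (Ultrafilter (ULift.{z} G)) := borel _
  have : BorelSpace (Ultrafilter (ULift.{z} G)) := ⟨rfl⟩
  obtain ⟨ν, _, hν⟩ := hG (Ultrafilter (ULift.{z} G))
  let B : Set G → Set (Ultrafilter (ULift.{z} G)) := fun X => {U | ULift.down ⁻¹' X ∈ U}
  have hB : ∀ X, MeasurableSet (B X) := fun X => (ultrafilter_isOpen_basic _).measurableSet
  refine ⟨⟨fun X => ν.real (B X), fun X => ⟨measureReal_nonneg, measureReal_le_one⟩, ?_, ?_⟩, ?_⟩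
  · have : B Set.univ = Set.univ := Set.eq_univ_of_forall fun U => univ_mem
    simp [this]
  · intro X Y hXY
    have hu : B (X ∪ Y) = B X ∪ B Y := by
      ext U
      exact Ultrafilter.union_mem_iff
    have hd : Disjoint (B X) (B Y) := by
      rw [Set.disjoint_left]
      intro U hX hY
      refine U.empty_notMem ?_
      have := inter_mem hX hY
      rwa [← Set.preimage_inter, hXY.inter_eq, Set.preimage_empty] at this
    change ν.real _ = ν.real _ + ν.real _
    rw [hu, measureReal_union hd (hB Y)]
  · intro X g
    have : B (X <• g) = B X <• g := by
      ext U
      rw [Set.mem_smul_set_iff_inv_smul_mem]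
      change _ ↔ _ ∈ (MulOpposite.op g)⁻¹ • U
      rw [mem_smul_ultrafilter, inv_inv]
      change _ ∈ U ↔ _
      congr! 1
      ext x
      simp only [Set.mem_preimage, Set.mem_smul_set_iff_inv_smul_mem]
      rfl
    change ν.real _ = ν.real _
    rw [this, measureReal_def, hν g _ (hB X), measureReal_def]

end Ultrafilters

/-! ### From means to invariant Borel measures by Riesz representation -/

open CompactlySupported in
theorem hasInvariantMeasureProperty_of_mean {G : Type u} [Group G] (m : Mean G)
    (hm : m.IsRightInvariant) : HasInvariantMeasureProperty.{u, z} G := by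
  intro Ω _ _ _ hΩ _ _ _ _
  obtain ⟨ω⟩ := hΩ
  let orb : C_c(Ω, ℝ) → EllInfty G := fun f => ⟨fun h => f (ω <• h), memℓp_infty (by
    obtain ⟨R, hR⟩ := isCompact_univ.exists_bound_of_continuousOn f.continuous.continuousOn
    exact ⟨R, by rintro _ ⟨h, rfl⟩; exact hR _ trivial⟩)⟩
  let Λ : C_c(Ω, ℝ) →ₚ[ℝ] ℝ := PositiveLinearMap.mk₀
    { toFun := fun f => m.toLinearMap (orb f)
      map_add' := fun f f' => by rw [← map_add]; rfl
      map_smul' := fun c f => by rw [← map_smul]; rfl }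
    fun f hf => m.nonneg _ fun h => hf _
  let μ := RealRMK.rieszMeasure Λ
  have hμ : ∀ f : C_c(Ω, ℝ), ∫ x, f x ∂μ = m.toLinearMap (orb f) :=
    fun f => RealRMK.integral_rieszMeasure Λ f
  have hone : ∫ _, (1 : ℝ) ∂μ = 1 := by
    exact (hμ ⟨1, HasCompactSupport.of_compactSpace _⟩).trans m.map_one
  have hprob : IsProbabilityMeasure μ := by
    rw [isProbabilityMeasure_iff_real]
    simpa using hone
  have hinv : ∀ g : G, μ.map (fun x => x <• g) = μ := by
    intro g
    -- Regularity lets integrals of continuous functions determine the translated measure.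
    have : (μ.map (Homeomorph.smul (MulOpposite.op g))).Regular := Measure.Regular.map _
    refine Measure.ext_of_integral_eq_on_compactlySupported
      (μ := μ.map (Homeomorph.smul (MulOpposite.op g))) fun f => ?_
    rw [(Homeomorph.smul (α := Ω) (MulOpposite.op g)).measurableEmbedding.integral_map]
    refine (hμ ⟨⟨fun x => f (x <• g), f.continuous.comp (continuous_const_smul _)⟩,
      HasCompactSupport.of_compactSpace _⟩).trans ?_
    rw [hμ, ← hm (orb f) g⁻¹]
    congr 1
    ext h
    change f ((ω <• h) <• g) = f (ω <• (h * g⁻¹⁻¹))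
    rw [inv_inv, MulOpposite.op_mul, mul_smul]
  refine ⟨μ, hprob, fun g A hA => ?_⟩
  have hA' : (fun x : Ω => x <• g⁻¹) ⁻¹' A = A <• g := by
    ext x
    rw [Set.mem_smul_set_iff_inv_smul_mem]
    rfl
  conv_rhs => rw [← hinv g⁻¹]
  rw [Measure.map_apply (continuous_const_smul _).measurable hA, hA']

end AmenableGroup

theorem mainTheorem1 (G : Type u) [Group G] :
    List.TFAE [
      ∃ μ : AmenableGroup.FinAddProbMeasure G, μ.IsRightInvariant,
      ∃ m : AmenableGroup.Mean G, m.IsRightInvariant,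
      AmenableGroup.FolnerCondition G,
      AmenableGroup.HasFolnerNet.{u, v} G,
      ¬ AmenableGroup.IsParadoxical G,
      AmenableGroup.HasFixedPointProperty.{u, w} G,
      AmenableGroup.HasInvariantMeasureProperty.{u, z} G] := by
  tfae_have 2 → 1 := fun ⟨m, hm⟩ => ⟨m.toFinAddProbMeasure, hm.toFinAddProbMeasure⟩
  tfae_have 1 → 5 := fun ⟨μ, hμ⟩ => AmenableGroup.not_isParadoxical_of_finAddProbMeasure μ hμ
  tfae_have 5 → 3 := AmenableGroup.folnerCondition_of_not_isParadoxical
  tfae_have 3 → 4 := AmenableGroup.hasFolnerNet_of_folnerCondition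
  tfae_have 4 → 2 := AmenableGroup.exists_mean_of_hasFolnerNet
  tfae_have 4 → 6 := AmenableGroup.hasFixedPointProperty_of_hasFolnerNet
  tfae_have 6 → 1 := AmenableGroup.exists_finAddProbMeasure_of_hasFixedPointProperty
  tfae_have 2 → 7 := fun ⟨m, hm⟩ => AmenableGroup.hasInvariantMeasureProperty_of_mean m hm
  tfae_have 7 → 1 := AmenableGroup.exists_finAddProbMeasure_of_hasInvariantMeasureProperty
  tfae_finish
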